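/- **Theorem 3.1.** Let $V=\coprod_{n\in\mathbb Z}V_{(n)}$ be a vertex operator algebra over $\mathbb C$ (in the sense of Frenkel–Lepowsky–Meurman and Frenkel–Huang–Lepowsky), with $Y(u,x)=\sum_{n\in\mathbb Z}u_nx^{-n-1}$, conformal vector $\omega$ and $L(n)=\omega_{n+1}$, and put $V_+=\coprod_{n>0}V_{(n)}$. A *discretely $\mathbb R$-graded $V$-module* is an $\mathbb R$-graded $V$-module $W=\coprod_{r\in\mathbb R}W_{(r)}$ (graded by $L(0)$-eigenvalues) such that $\coprod_{s\le r}W_{(s)}$ is finite-dimensional for every $r\in\mathbb R$. Its contragredient $W'=\coprod_{r}W_{(r)}^*$ has the vertex operator map determined by $\langle Y'(v,x)w',w\rangle=\langle w',Y(e^{xL(1)}(-x^{-2})^{L(0)}v,x^{-1})w\rangle$. For $U=W$ or $U=W'$ let $C_1(U)$ be the linear span of all $u_{-1}w$ with $u\in V_+$ and $w\in U$; $U$ is called *$C_1$-cofinite* if $\dim U/C_1(U)<\infty$. For $V$-modules $W_1,W_2,W_3$, an *intertwining operator* of type $\binom{W_3}{W_1W_2}$ is a linear map $\mathcal Y(\cdot,x)\colon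 W_1\to \operatorname{Hom}(W_2,W_3)\{x\}$, $w_1\mapsto\sum_{n\in\mathbb C}(w_1)_nx^{-n-1}$, such that $(w_1)_nw_2=0$ whenever the real part of $n$ is sufficiently large (depending on $w_1\in W_1$, $w_2\in W_2$), the Jacobi identity $$x_0^{-1}\delta\Big(\frac{x_1-x_2}{x_0}\Big)Y(v,x_1)\mathcal Y(w_1,x_2)w_2-x_0^{-1}\delta\Big(\frac{x_2-x_1}{-x_0}\Big)\mathcal Y(w_1,x_2)Y(v,x_1)w_2=x_2^{-1}\delta\Big(\frac{x_1-x_0}{x_2}\Big)\mathcal Y(Y(v,x_0)w_1,x_2)w_2$$ holds for $v\in V$, $w_1\in W_1$, $w_2\in W_2$, and $\frac{d}{dx}\mathcal Y(w_1,x)=\mathcal Y(L(-1)w_1,x)$. The *fusion rule* among $W_1,W_2,W_3$ is the dimension of the vector space of these intertwining operators. Let $W_1,W_2,W_3$ be discretely $\mathbb R$-graded $V$-modules such that $W_1$, $W_2$ and $W_3'$ are $C_1$-cofinite. Then the space of intertwining operators of type $\binom{W_3}{W_1W_2}$ is finite-dimensional; that is, the fusion rule among $W_1$, $W_2$ and $W_3$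 is finite. -/

import Mathlib

noncomputable section

open VertexOperator (ncoeff)

/-- A vertex operator algebra over `ℂ`. The vertex operator map is `Y(u, x) = ∑ uₙ x^(-n-1)`, where
`uₙ` is written `ncoeff (Y u) n`; that `uₙ v = 0` for `n` large is part of the type `VertexOperator`, so
all the sums in the Jacobi identity have finitely many nonzero terms. -/
structure VertexOperatorAlgebra (V : Type*) [AddCommGroup V] [Module ℂ V] where
  /-- the homogeneous subspaces `V₍ₙ₎` -/
  grading : ℤ → Submodule ℂ V
  isInternal : DirectSum.IsInternal grading
  finiteDimensional : ∀ n, FiniteDimensional ℂ (grading n)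
  lower_bounded : ∃ N : ℤ, ∀ n < N, grading n = ⊥
  /-- the vertex operator map -/
  Y : V →ₗ[ℂ] VertexOperator ℂ V
  /-- the vacuum vector `𝟏` -/
  vacuum : V
  /-- the conformal vector, whose modes are `L(n) = ωₙ₊₁` -/
  ω : V
  /-- the rank (central charge) -/
  rank : ℂ
  vacuum_mem : vacuum ∈ grading 0
  ω_mem : ω ∈ grading 2
  /-- `Y(𝟏, x) = 1` -/
  vacuum_mode : ∀ (n : ℤ) (v : V), (ncoeff (Y vacuum) n) v = if n = -1 then v else 0
  /-- `Y(v, x)𝟏` has no negative powers of `x`, and constant term `v` -/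
  creation : ∀ v : V, (∀ n : ℤ, 0 ≤ n → (ncoeff (Y v) n) vacuum = 0) ∧ (ncoeff (Y v) (-1)) vacuum = v
  /-- The Jacobi identity: the coefficient of `x₀^(-l-1) x₁^(-m-1) x₂^(-n-1)`. -/
  jacobi : ∀ (u v w : V) (l m n : ℤ),
    (∑ᶠ i : ℕ, ((-1 : ℂ) ^ i * (Ring.choose l i : ℤ)) • (ncoeff (Y u) (m + l - i)) ((ncoeff (Y v) (n + i)) w))
      - (∑ᶠ i : ℕ, ((-1 : ℂ) ^ l * (-1 : ℂ) ^ i * (Ring.choose l i : ℤ)) •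
          (ncoeff (Y v) (n + l - i)) ((ncoeff (Y u) (m + i)) w))
    = ∑ᶠ i : ℕ, ((Ring.choose m i : ℤ) : ℂ) • (ncoeff (Y ((ncoeff (Y u) (l + i)) v)) (m + n - i)) w
  virasoro : ∀ (m n : ℤ) (v : V),
    (ncoeff (Y ω) (m + 1)) ((ncoeff (Y ω) (n + 1)) v) - (ncoeff (Y ω) (n + 1)) ((ncoeff (Y ω) (m + 1)) v)
      = ((m : ℂ) - n) • (ncoeff (Y ω) (m + n + 1)) v
        + (if m + n = 0 then ((m : ℂ) ^ 3 - m) / 12 * rank else 0) • v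
  /-- `L(0) v = n v` for `v ∈ V₍ₙ₎` -/
  L_zero : ∀ (n : ℤ), ∀ v ∈ grading n, (ncoeff (Y ω) 1) v = (n : ℂ) • v
  /-- `(d/dx) Y(v, x) = Y(L(-1)v, x)` -/
  L_neg_one : ∀ (v w : V) (n : ℤ), (ncoeff (Y ((ncoeff (Y ω) 0) v)) n) w = -(n : ℂ) • (ncoeff (Y v) (n - 1)) w

/-- An `ℝ`-graded module `W` for the vertex operator algebra `V`. -/
structure RGradedModule {V : Type*} [AddCommGroup V] [Module ℂ V] (𝒱 : VertexOperatorAlgebra V)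
    (W : Type*) [AddCommGroup W] [Module ℂ W] where
  /-- the homogeneous subspaces `W₍ᵣ₎` -/
  grading : ℝ → Submodule ℂ W
  isInternal : DirectSum.IsInternal grading
  finiteDimensional : ∀ r, FiniteDimensional ℂ (grading r)
  lower_bounded : ∃ N : ℝ, ∀ r < N, grading r = ⊥
  /-- the vertex operator map -/
  Y : V →ₗ[ℂ] VertexOperator ℂ W
  vacuum_mode : ∀ (n : ℤ) (w : W), (ncoeff (Y 𝒱.vacuum) n) w = if n = -1 then w else 0
  jacobi : ∀ (u v : V) (w : W) (l m n : ℤ),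
    (∑ᶠ i : ℕ, ((-1 : ℂ) ^ i * (Ring.choose l i : ℤ)) • (ncoeff (Y u) (m + l - i)) ((ncoeff (Y v) (n + i)) w))
      - (∑ᶠ i : ℕ, ((-1 : ℂ) ^ l * (-1 : ℂ) ^ i * (Ring.choose l i : ℤ)) •
          (ncoeff (Y v) (n + l - i)) ((ncoeff (Y u) (m + i)) w))
    = ∑ᶠ i : ℕ, ((Ring.choose m i : ℤ) : ℂ) • (ncoeff (Y ((ncoeff (𝒱.Y u) (l + i)) v)) (m + n - i)) w
  virasoro : ∀ (m n : ℤ) (w : W),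
    (ncoeff (Y 𝒱.ω) (m + 1)) ((ncoeff (Y 𝒱.ω) (n + 1)) w) - (ncoeff (Y 𝒱.ω) (n + 1)) ((ncoeff (Y 𝒱.ω) (m + 1)) w)
      = ((m : ℂ) - n) • (ncoeff (Y 𝒱.ω) (m + n + 1)) w
        + (if m + n = 0 then ((m : ℂ) ^ 3 - m) / 12 * 𝒱.rank else 0) • w
  L_zero : ∀ (r : ℝ), ∀ w ∈ grading r, (ncoeff (Y 𝒱.ω) 1) w = (r : ℂ) • w
  L_neg_one : ∀ (v : V) (w : W) (n : ℤ),
    (ncoeff (Y ((ncoeff (𝒱.Y 𝒱.ω) 0) v)) n) w = -(n : ℂ) • (ncoeff (Y v) (n - 1)) w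

/-- The sum of the homogeneous subspaces of weight at most `r` is finite-dimensional for all `r`. -/
def RGradedModule.IsDiscretelyGraded {V : Type*} [AddCommGroup V] [Module ℂ V]
    {𝒱 : VertexOperatorAlgebra V} {W : Type*} [AddCommGroup W] [Module ℂ W]
    (M : RGradedModule 𝒱 W) : Prop :=
  ∀ r : ℝ, FiniteDimensional ℂ (⨆ s : Set.Iic r, M.grading s : Submodule ℂ W)

/-- `V₊ = ∐_{n > 0} V₍ₙ₎` -/
def VertexOperatorAlgebra.positivePart {V : Type*} [AddCommGroup V] [Module ℂ V]
    (𝒱 : VertexOperatorAlgebra V) : Submodule ℂ V :=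
  ⨆ n : Set.Ioi (0 : ℤ), 𝒱.grading n

/-- `C₁(W)`: the span of the `u₋₁ w` for `u ∈ V₊` and `w ∈ W`. -/
def C1Subspace {V : Type*} [AddCommGroup V] [Module ℂ V] (𝒱 : VertexOperatorAlgebra V)
    {W : Type*} [AddCommGroup W] [Module ℂ W] (Y : V →ₗ[ℂ] VertexOperator ℂ W) :
    Submodule ℂ W :=
  Submodule.span ℂ {x | ∃ u ∈ 𝒱.positivePart, ∃ w : W, (ncoeff (Y u) (-1)) w = x}

/-- `dim W / C₁(W) < ∞` -/
def IsC1Cofinite {V : Type*} [AddCommGroup V] [Module ℂ V] (𝒱 : VertexOperatorAlgebra V)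
    {W : Type*} [AddCommGroup W] [Module ℂ W] (Y : V →ₗ[ℂ] VertexOperator ℂ W) : Prop :=
  FiniteDimensional ℂ (W ⧸ C1Subspace 𝒱 Y)

/-! ### Homogeneity of modes -/

theorem VertexOperator.finite_support_mode {W : Type*} [AddCommGroup W] [Module ℂ W]
    (A : VertexOperator ℂ W) (w : W) (a : ℤ) :
    {i : ℕ | (ncoeff (A) (a + i)) w ≠ 0}.Finite := by
  refine (Set.finite_lt_nat
    ((-((HahnModule.of ℂ).symm (A w)).order - a).toNat + 1)).subset ?_
  intro i hi
  by_contra h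
  refine hi (VertexOperator.ncoeff_eq_zero_of_lt_order A _ _ ?_)
  simp only [Set.mem_ofPred_eq, not_lt] at h
  omega

/-- If `T` acts on the pieces of a decomposition by distinct scalars, then the pieces are the
eigenspaces of `T`. -/
theorem mem_grading_of_eigenvector {ι W : Type*} [DecidableEq ι] [AddCommGroup W] [Module ℂ W]
    {g : ι → Submodule ℂ W} (hg : DirectSum.IsInternal g) (T : Module.End ℂ W) (c : ι → ℂ)
    (hc : Function.Injective c) (hT : ∀ i, ∀ w ∈ g i, T w = c i • w)
    (j : ι) (w : W) (hw : T w = c j • w) : w ∈ g j := by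
  have hle : ∀ i, g i ≤ T.eigenspace (c i) := fun i x hx =>
    Module.End.mem_eigenspace_iff.2 (hT i x hx)
  have htop : g j ⊔ (⨆ i : {i // i ≠ j}, g i) = ⊤ := by
    rw [eq_top_iff, ← hg.submodule_iSup_eq_top]
    refine iSup_le fun i => ?_
    by_cases h : i = j
    · subst h; exact le_sup_left
    · exact le_sup_of_le_right (le_iSup (fun i : {i // i ≠ j} => g i) ⟨i, h⟩)
  obtain ⟨a, ha, b, hb, rfl⟩ := Submodule.mem_sup.1 (htop ▸ Submodule.mem_top : w ∈ _)
  have hb1 : b ∈ T.eigenspace (c j) := by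
    have := (T.eigenspace (c j)).sub_mem (Module.End.mem_eigenspace_iff.2 hw) (hle j ha)
    simpa using this
  have hb2 : b ∈ ⨆ μ, ⨆ (_ : μ ≠ c j), T.eigenspace μ := by
    refine (iSup_le fun i => ?_ : (⨆ i : {i // i ≠ j}, g i) ≤ _) hb
    exact (hle i).trans
      (le_iSup₂_of_le (c i) (fun h => i.2 (hc h)) le_rfl)
  have := (Submodule.disjoint_def.1 ((Module.End.eigenspaces_iSupIndep T) (c j))) b hb1 hb2
  simpa [this] using ha

/-- `[L(0), vₙ] = (wt v - n - 1) vₙ`, as a consequence of a Jacobi identity. -/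
theorem L_zero_mode_aux {V W : Type*} [AddCommGroup V] [Module ℂ V]
    [AddCommGroup W] [Module ℂ W] (𝒱 : VertexOperatorAlgebra V) (Y : V →ₗ[ℂ] VertexOperator ℂ W)
    (jacobi : ∀ (u v : V) (w : W) (l m n : ℤ),
      (∑ᶠ i : ℕ, ((-1 : ℂ) ^ i * (Ring.choose l i : ℤ)) • (ncoeff (Y u) (m + l - i)) ((ncoeff (Y v) (n + i)) w))
        - (∑ᶠ i : ℕ, ((-1 : ℂ) ^ l * (-1 : ℂ) ^ i * (Ring.choose l i : ℤ)) •
            (ncoeff (Y v) (n + l - i)) ((ncoeff (Y u) (m + i)) w))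
      = ∑ᶠ i : ℕ, ((Ring.choose m i : ℤ) : ℂ) • (ncoeff (Y ((ncoeff (𝒱.Y u) (l + i)) v)) (m + n - i)) w)
    (L_neg_one : ∀ (v : V) (w : W) (n : ℤ),
      (ncoeff (Y ((ncoeff (𝒱.Y 𝒱.ω) 0) v)) n) w = -(n : ℂ) • (ncoeff (Y v) (n - 1)) w)
    (m n : ℤ) (v : V) (hv : v ∈ 𝒱.grading m) (r : ℂ) (w : W) (hw : (ncoeff (Y 𝒱.ω) 1) w = r • w) :
    (ncoeff (Y 𝒱.ω) 1) ((ncoeff (Y v) n) w) = (r + m - n - 1) • (ncoeff (Y v) n) w := by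
  have h := jacobi 𝒱.ω v w 0 1 n
  rw [finsum_eq_single _ 0, finsum_eq_single _ 0,
    finsum_eq_sum_of_support_subset (s := Finset.range 2)] at h
  · simp only [Finset.sum_range_succ, Finset.sum_range_zero] at h
    have e0 : (1 : ℤ) + n - ((0 : ℕ) : ℤ) = n + 1 := by simp; ring
    have e1 : (1 : ℤ) + n - ((1 : ℕ) : ℤ) = n := by simp
    rw [e0, e1] at h
    simp only [pow_zero, Ring.choose_zero_right, Int.cast_one, mul_one, one_smul, Nat.cast_zero,
      add_zero, sub_zero, zpow_zero, hw, map_smul, zero_add, L_neg_one,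
      Ring.choose_one_right, Nat.cast_one, 𝒱.L_zero m v hv, LinearMap.smul_apply,
      Pi.smul_apply, add_sub_cancel_right] at h
    rw [sub_eq_iff_eq_add] at h
    rw [h]
    push_cast
    module
  · intro i hi
    simp only [Function.mem_support] at hi
    by_contra hlt
    apply hi
    have : Ring.choose (1 : ℤ) i = 0 := by
      have h2 : 1 < i := by simpa using hlt
      have := Ring.choose_natCast (R := ℤ) 1 i
      rw [Nat.choose_eq_zero_of_lt h2] at this
      simpa using this
    simp [this]
  · intro i hi
    simp [Ring.choose_zero_pos ℤ (Nat.pos_of_ne_zero hi)]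
  · intro i hi
    simp [Ring.choose_zero_pos ℤ (Nat.pos_of_ne_zero hi)]

theorem VertexOperatorAlgebra.mode_mem {V : Type*} [AddCommGroup V] [Module ℂ V]
    (𝒱 : VertexOperatorAlgebra V) {m k : ℤ} (n : ℤ) {v w : V} (hv : v ∈ 𝒱.grading m)
    (hw : w ∈ 𝒱.grading k) : (ncoeff (𝒱.Y v) n) w ∈ 𝒱.grading (k + m - n - 1) := by
  refine mem_grading_of_eigenvector 𝒱.isInternal _ (fun i : ℤ => (i : ℂ)) Int.cast_injective
    𝒱.L_zero _ _ ?_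
  have := L_zero_mode_aux 𝒱 𝒱.Y 𝒱.jacobi 𝒱.L_neg_one m n v hv k w (𝒱.L_zero k w hw)
  rw [this]; push_cast; rfl

theorem RGradedModule.mode_mem {V : Type*} [AddCommGroup V] [Module ℂ V]
    {𝒱 : VertexOperatorAlgebra V} {W : Type*} [AddCommGroup W] [Module ℂ W]
    (M : RGradedModule 𝒱 W) {m : ℤ} {r : ℝ} (n : ℤ) {v : V} {w : W} (hv : v ∈ 𝒱.grading m)
    (hw : w ∈ M.grading r) : (ncoeff (M.Y v) n) w ∈ M.grading (r + m - n - 1) := by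
  refine mem_grading_of_eigenvector M.isInternal _ (fun i : ℝ => (i : ℂ)) Complex.ofReal_injective
    M.L_zero _ _ ?_
  have := L_zero_mode_aux 𝒱 M.Y M.jacobi M.L_neg_one m n v hv r w (M.L_zero r w hw)
  rw [this]; push_cast; rfl

theorem VertexOperatorAlgebra.L_one_pow_mem {V : Type*} [AddCommGroup V] [Module ℂ V]
    (𝒱 : VertexOperatorAlgebra V) {m : ℤ} {v : V} (hv : v ∈ 𝒱.grading m) (k : ℕ) :
    (((ncoeff (𝒱.Y 𝒱.ω) 2)) ^ k) v ∈ 𝒱.grading (m - k) := by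
  induction k with
  | zero => simpa using hv
  | succ k ih =>
    have := 𝒱.mode_mem 2 𝒱.ω_mem ih
    rw [pow_succ', Module.End.mul_apply]
    convert this using 2
    push_cast; ring

theorem VertexOperatorAlgebra.finite_L_one_pow {V : Type*} [AddCommGroup V] [Module ℂ V]
    (𝒱 : VertexOperatorAlgebra V) {m : ℤ} {v : V} (hv : v ∈ 𝒱.grading m) :
    {k : ℕ | (((ncoeff (𝒱.Y 𝒱.ω) 2)) ^ k) v ≠ 0}.Finite := by
  obtain ⟨N, hN⟩ := 𝒱.lower_bounded
  refine (Set.finite_le_nat (m - N).toNat).subset fun k hk => ?_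
  by_contra h
  simp only [Set.mem_ofPred_eq, not_le] at h
  have h1 := 𝒱.L_one_pow_mem hv k
  rw [hN _ (by omega)] at h1
  exact hk (by simpa using h1)

/-! ### The contragredient module -/

namespace RGradedModule

variable {V : Type*} [AddCommGroup V] [Module ℂ V] {𝒱 : VertexOperatorAlgebra V}
  {W : Type*} [AddCommGroup W] [Module ℂ W]

/-- The graded dual `W' = ∐ᵣ (W₍ᵣ₎)*`, as the functionals on `W` which vanish on all but finitely
many of the homogeneous subspaces. -/
def gradedDual (M : RGradedModule 𝒱 W) : Submodule ℂ (Module.Dual ℂ W) where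
  carrier := {φ | {r : ℝ | ∃ w ∈ M.grading r, φ w ≠ 0}.Finite}
  zero_mem' := by simp
  add_mem' := by
    intro φ ψ hφ hψ
    refine (Set.Finite.union hφ hψ).subset ?_
    rintro r ⟨w, hw, h⟩
    by_cases h1 : φ w = 0
    · exact Or.inr ⟨w, hw, by simpa [h1] using h⟩
    · exact Or.inl ⟨w, hw, h1⟩
  smul_mem' := by
    intro c φ hφ
    refine Set.Finite.subset hφ ?_
    rintro r ⟨w, hw, h⟩
    exact ⟨w, hw, fun h1 => h (by simp [h1])⟩

/-- For `v ∈ V₍ₘ₎`, the coefficient of `x^(-j-1)` in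
`Y(e^{xL(1)} (-x⁻²)^{L(0)} v, x⁻¹) = (-1)^m ∑ₖ ∑ₙ (1/k!) (L(1)^k v)ₙ x^(k-2m+n+1)`. -/
def oppositeModeAux (M : RGradedModule 𝒱 W) (j m : ℤ) :
    𝒱.grading m →ₗ[ℂ] Module.End ℂ W where
  toFun v := (-1 : ℂ) ^ m • ∑ᶠ k : ℕ, ((k.factorial : ℂ)⁻¹) •
    (ncoeff (M.Y ((((ncoeff (𝒱.Y 𝒱.ω) 2)) ^ k) v)) (2 * m - k - j - 2))
  map_add' u v := by
    rw [← smul_add, ← finsum_add_distrib]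
    · simp
    · refine (𝒱.finite_L_one_pow u.2).subset fun k hk h => hk ?_
      simp [h]
    · refine (𝒱.finite_L_one_pow v.2).subset fun k hk h => hk ?_
      simp [h]
  map_smul' c v := by
    rw [RingHom.id_apply, smul_comm c, smul_finsum c]
    simp only [Submodule.coe_smul, map_smul, Pi.smul_apply, smul_comm c]

theorem coeLinearMap_bijective (𝒱 : VertexOperatorAlgebra V) :
    Function.Bijective (DirectSum.coeLinearMap 𝒱.grading) :=
  𝒱.isInternal

/-- The coefficient of `x^(-j-1)` in `Y(e^{xL(1)} (-x⁻²)^{L(0)} v, x⁻¹)`, for all `v ∈ V`. -/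
def oppositeMode (M : RGradedModule 𝒱 W) (j : ℤ) : V →ₗ[ℂ] Module.End ℂ W :=
  (DirectSum.toModule ℂ ℤ _ fun m => M.oppositeModeAux j m) ∘ₗ
    (LinearEquiv.ofBijective (DirectSum.coeLinearMap 𝒱.grading)
      (coeLinearMap_bijective 𝒱)).symm.toLinearMap

theorem oppositeMode_of_mem (M : RGradedModule 𝒱 W) (j : ℤ) {m : ℤ} {v : V}
    (hv : v ∈ 𝒱.grading m) :
    M.oppositeMode j v = (-1 : ℂ) ^ m • ∑ᶠ k : ℕ, ((k.factorial : ℂ)⁻¹) •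
      (ncoeff (M.Y ((((ncoeff (𝒱.Y 𝒱.ω) 2)) ^ k) v)) (2 * m - k - j - 2)) := by
  have : (LinearEquiv.ofBijective (DirectSum.coeLinearMap 𝒱.grading)
      (coeLinearMap_bijective 𝒱)).symm v
      = DirectSum.lof ℂ ℤ (fun i => 𝒱.grading i) m ⟨v, hv⟩ := by
    rw [LinearEquiv.symm_apply_eq]
    exact (DirectSum.coeLinearMap_lof 𝒱.grading m ⟨v, hv⟩).symm
  simp only [oppositeMode, LinearMap.comp_apply, LinearEquiv.coe_coe, this,
    DirectSum.toModule_lof]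
  rfl

theorem oppositeMode_mem (M : RGradedModule 𝒱 W) (j : ℤ) {m : ℤ} {v : V}
    (hv : v ∈ 𝒱.grading m) {r : ℝ} {w : W} (hw : w ∈ M.grading r) :
    M.oppositeMode j v w ∈ M.grading (r + j + 1 - m) := by
  have hfin : (Function.support fun k : ℕ => ((k.factorial : ℂ)⁻¹) •
      (ncoeff (M.Y ((((ncoeff (𝒱.Y 𝒱.ω) 2)) ^ k) v)) (2 * m - k - j - 2))).Finite :=
    (𝒱.finite_L_one_pow hv).subset fun k hk h => hk (by simp [h])
  rw [M.oppositeMode_of_mem j hv, finsum_eq_sum _ hfin, LinearMap.smul_apply,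
    LinearMap.sum_apply]
  refine Submodule.smul_mem _ _ (Submodule.sum_mem _ fun k _ => ?_)
  rw [LinearMap.smul_apply]
  refine Submodule.smul_mem _ _ ?_
  convert M.mode_mem (2 * m - k - j - 2) (𝒱.L_one_pow_mem hv k) hw using 2
  push_cast; ring

theorem homogeneous_induction (𝒱 : VertexOperatorAlgebra V) {p : V → Prop} (zero : p 0)
    (hom : ∀ m, ∀ v ∈ 𝒱.grading m, p v) (add : ∀ u v, p u → p v → p (u + v)) (v : V) : p v := by
  have : v ∈ ⨆ m, 𝒱.grading m := by rw [𝒱.isInternal.submodule_iSup_eq_top]; trivial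
  exact Submodule.iSup_induction _ (motive := p) this hom zero add

theorem comp_oppositeMode_mem (M : RGradedModule 𝒱 W) (j : ℤ) (v : V) {φ : Module.Dual ℂ W}
    (hφ : φ ∈ M.gradedDual) : φ ∘ₗ M.oppositeMode j v ∈ M.gradedDual := by
  induction v using homogeneous_induction 𝒱 with
  | zero => simp
  | add u v hu hv => rw [map_add, LinearMap.comp_add]; exact add_mem hu hv
  | hom m v hv =>
    have hφ' : {r : ℝ | ∃ w ∈ M.grading r, φ w ≠ 0}.Finite := hφ
    refine (hφ'.preimage (f := fun r : ℝ => r + j + 1 - m) ?_).subset ?_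
    · intro a _ b _ h
      simpa using h
    · rintro r ⟨w, hw, h⟩
      exact ⟨_, M.oppositeMode_mem j hv hw, h⟩

/-- The mode `vⱼ` on `W'`: `⟨vⱼ w', w⟩` is the coefficient of `x^(-j-1)` in
`⟨w', Y(e^{xL(1)} (-x⁻²)^{L(0)} v, x⁻¹) w⟩`. -/
def contragredientMode (M : RGradedModule 𝒱 W) (v : V) (j : ℤ) : Module.End ℂ M.gradedDual where
  toFun φ := ⟨φ.1 ∘ₗ M.oppositeMode j v, M.comp_oppositeMode_mem j v φ.2⟩
  map_add' _ _ := rfl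
  map_smul' _ _ := rfl

theorem contragredientMode_add (M : RGradedModule 𝒱 W) (u v : V) (j : ℤ) :
    M.contragredientMode (u + v) j = M.contragredientMode u j + M.contragredientMode v j := by
  ext φ w; simp [contragredientMode]

theorem contragredientMode_smul (M : RGradedModule 𝒱 W) (c : ℂ) (v : V) (j : ℤ) :
    M.contragredientMode (c • v) j = c • M.contragredientMode v j := by
  ext φ w; simp [contragredientMode]

theorem contragredient_bddBelow (M : RGradedModule 𝒱 W) (v : V) (φ : M.gradedDual) :
    BddBelow (Function.support fun n : ℤ => M.contragredientMode v (-n - 1) φ) := by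
  induction v using homogeneous_induction 𝒱 with
  | zero =>
    have : ∀ j, M.contragredientMode 0 j = 0 := fun j => by
      simpa using M.contragredientMode_smul 0 0 j
    simp [this, Function.support]
  | add u v hu hv =>
    refine (hu.union hv).mono fun n hn => ?_
    by_contra h
    simp only [Set.mem_union, Function.mem_support, not_or, not_not] at h
    apply hn
    simp [contragredientMode_add, h.1, h.2]
  | hom m v hv =>
    obtain ⟨N, hN⟩ := M.lower_bounded
    obtain ⟨B, hB⟩ := (show {r : ℝ | ∃ w ∈ M.grading r, φ.1 w ≠ 0}.Finite from φ.2).bddAbove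
    refine ⟨⌊N - B - m⌋, fun n hn => ?_⟩
    have hne : ∃ r, ∃ w ∈ M.grading r, φ.1 (M.oppositeMode (-n - 1) v w) ≠ 0 := by
      by_contra! h
      apply hn
      have hle : (⨆ r, M.grading r) ≤ LinearMap.ker (φ.1 ∘ₗ M.oppositeMode (-n - 1) v) :=
        iSup_le fun r w hw => h r w hw
      rw [M.isInternal.submodule_iSup_eq_top] at hle
      ext w
      exact hle (Submodule.mem_top (x := w))
    obtain ⟨r, w, hw, h⟩ := hne
    have h1 := hB ⟨_, M.oppositeMode_mem _ hv hw, h⟩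
    have h2 : N ≤ r := by
      by_contra! hlt
      rw [hN r hlt, Submodule.mem_bot] at hw
      simp [hw] at h
    have h3 : N - B - m ≤ (n : ℝ) := by push_cast at h1; linarith
    exact_mod_cast (Int.floor_le _).trans h3

/-- The vertex operator map of the contragredient module `W'`, defined by
`⟨Y'(v, x) w', w⟩ = ⟨w', Y(e^{xL(1)} (-x⁻²)^{L(0)} v, x⁻¹) w⟩`. -/
def contragredientY (M : RGradedModule 𝒱 W) : V →ₗ[ℂ] VertexOperator ℂ M.gradedDual where
  toFun v := VertexOperator.of_coeff (fun n => M.contragredientMode v (-n - 1))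
    (M.contragredient_bddBelow v)
  map_add' u v := by
    apply HVertexOperator.coeff_inj
    funext n
    rw [map_add]
    exact M.contragredientMode_add u v _
  map_smul' c v := by
    apply HVertexOperator.coeff_inj
    funext n
    rw [map_smul]
    exact M.contragredientMode_smul c v _

theorem contragredientY_mode (M : RGradedModule 𝒱 W) (v : V) (j : ℤ) (φ : M.gradedDual) (w : W) :
    ((ncoeff (M.contragredientY v) j) φ).1 w = φ.1 (M.oppositeMode j v w) := by
  have : (ncoeff (M.contragredientY v) j) = M.contragredientMode v j := by
    simp [contragredientY]
  rw [this]; rfl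

end RGradedModule

/-! ### Intertwining operators -/

section Intertwining

variable {V : Type*} [AddCommGroup V] [Module ℂ V] {𝒱 : VertexOperatorAlgebra V}
  {W₁ W₂ W₃ : Type*} [AddCommGroup W₁] [Module ℂ W₁] [AddCommGroup W₂] [Module ℂ W₂]
  [AddCommGroup W₃] [Module ℂ W₃]

/-- The map `w₁ ↦ ∑_{n ∈ ℂ} (w₁)ₙ x^(-n-1)` with coefficients `(w₁)ₙ = 𝒴 n w₁ : W₂ → W₃` is an
intertwining operator of type `(W₃; W₁ W₂)`. By the truncation condition (for `𝒴` and for modules)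
all the sums in the Jacobi identity have finitely many nonzero terms. -/
structure IsIntertwiningOperator (M₁ : RGradedModule 𝒱 W₁) (M₂ : RGradedModule 𝒱 W₂)
    (M₃ : RGradedModule 𝒱 W₃) (𝒴 : ℂ → W₁ →ₗ[ℂ] W₂ →ₗ[ℂ] W₃) : Prop where
  truncation : ∀ (w₁ : W₁) (w₂ : W₂), ∃ N : ℝ, ∀ n : ℂ, N ≤ n.re → 𝒴 n w₁ w₂ = 0
  /-- The Jacobi identity: the coefficient of `x₀^(-l-1) x₁^(-m-1) x₂^(-n-1)`. -/
  jacobi : ∀ (v : V) (w₁ : W₁) (w₂ : W₂) (l m : ℤ) (n : ℂ),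
    (∑ᶠ i : ℕ, ((-1 : ℂ) ^ i * (Ring.choose l i : ℤ)) •
        (ncoeff (M₃.Y v) (m + l - i)) (𝒴 (n + i) w₁ w₂))
      - (∑ᶠ i : ℕ, ((-1 : ℂ) ^ l * (-1 : ℂ) ^ i * (Ring.choose l i : ℤ)) •
          𝒴 (n + l - i) w₁ ((ncoeff (M₂.Y v) (m + i)) w₂))
    = ∑ᶠ i : ℕ, ((Ring.choose m i : ℤ) : ℂ) • 𝒴 (m + n - i) ((ncoeff (M₁.Y v) (l + i)) w₁) w₂
  /-- `(d/dx) 𝒴(w₁, x) = 𝒴(L(-1)w₁, x)` -/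
  L_neg_one : ∀ (w₁ : W₁) (w₂ : W₂) (n : ℂ),
    𝒴 n ((ncoeff (M₁.Y 𝒱.ω) 0) w₁) w₂ = -n • 𝒴 (n - 1) w₁ w₂

theorem finite_support_of_truncation {𝒴 : ℂ → W₁ →ₗ[ℂ] W₂ →ₗ[ℂ] W₃} {w₁ : W₁} {w₂ : W₂}
    (h : ∃ N : ℝ, ∀ n : ℂ, N ≤ n.re → 𝒴 n w₁ w₂ = 0) (n : ℂ) :
    {i : ℕ | 𝒴 (n + i) w₁ w₂ ≠ 0}.Finite := by
  obtain ⟨N, hN⟩ := h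
  refine (Set.finite_le_nat ⌈N - n.re⌉₊).subset fun i hi => ?_
  by_contra hlt
  simp only [Set.mem_ofPred_eq, not_le] at hlt
  refine hi (hN _ ?_)
  have := Nat.lt_of_ceil_lt hlt
  simp
  linarith

/-- The vector space of intertwining operators of type `(W₃; W₁ W₂)`. -/
def intertwiningOperators (M₁ : RGradedModule 𝒱 W₁) (M₂ : RGradedModule 𝒱 W₂)
    (M₃ : RGradedModule 𝒱 W₃) : Submodule ℂ (ℂ → W₁ →ₗ[ℂ] W₂ →ₗ[ℂ] W₃) where
  carrier := {𝒴 | IsIntertwiningOperator M₁ M₂ M₃ 𝒴}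
  zero_mem' := ⟨fun _ _ => ⟨0, fun _ _ => rfl⟩, by simp, by simp⟩
  add_mem' := by
    intro 𝒴 𝒵 h𝒴 h𝒵
    refine ⟨fun w₁ w₂ => ?_, fun v w₁ w₂ l m n => ?_, fun w₁ w₂ n => ?_⟩
    · obtain ⟨N, hN⟩ := h𝒴.truncation w₁ w₂
      obtain ⟨N', hN'⟩ := h𝒵.truncation w₁ w₂
      exact ⟨max N N', fun n hn => by
        simp [hN n ((le_max_left _ _).trans hn), hN' n ((le_max_right _ _).trans hn)]⟩
    · have fin1 : ∀ 𝒳, IsIntertwiningOperator M₁ M₂ M₃ 𝒳 →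
          (Function.support fun i : ℕ => ((-1 : ℂ) ^ i * (Ring.choose l i : ℤ)) •
            (ncoeff (M₃.Y v) (m + l - i)) (𝒳 (n + i) w₁ w₂)).Finite := fun 𝒳 h =>
        (finite_support_of_truncation (h.truncation w₁ w₂) n).subset
          fun i hi h0 => hi (by simp [h0])
      have fin2 : ∀ 𝒳, IsIntertwiningOperator M₁ M₂ M₃ 𝒳 →
          (Function.support fun i : ℕ => ((-1 : ℂ) ^ l * (-1 : ℂ) ^ i * (Ring.choose l i : ℤ)) •
            𝒳 (n + l - i) w₁ ((ncoeff (M₂.Y v) (m + i)) w₂)).Finite := fun 𝒳 _ =>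
        ((M₂.Y v).finite_support_mode w₂ m).subset fun i hi h0 => hi (by simp [h0])
      have fin3 : ∀ 𝒳, IsIntertwiningOperator M₁ M₂ M₃ 𝒳 →
          (Function.support fun i : ℕ => ((Ring.choose m i : ℤ) : ℂ) •
            𝒳 (m + n - i) ((ncoeff (M₁.Y v) (l + i)) w₁) w₂).Finite := fun 𝒳 _ =>
        ((M₁.Y v).finite_support_mode w₁ l).subset fun i hi h0 => hi (by simp [h0])
      simp only [Pi.add_apply, LinearMap.add_apply, map_add, smul_add]
      rw [finsum_add_distrib (fin1 _ h𝒴) (fin1 _ h𝒵), finsum_add_distrib (fin2 _ h𝒴) (fin2 _ h𝒵),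
        finsum_add_distrib (fin3 _ h𝒴) (fin3 _ h𝒵), ← h𝒴.jacobi, ← h𝒵.jacobi]
      abel
    · simp [h𝒴.L_neg_one, h𝒵.L_neg_one]
  smul_mem' := by
    intro c 𝒴 h𝒴
    refine ⟨fun w₁ w₂ => ?_, fun v w₁ w₂ l m n => ?_, fun w₁ w₂ n => ?_⟩
    · obtain ⟨N, hN⟩ := h𝒴.truncation w₁ w₂
      exact ⟨N, fun n hn => by simp [hN n hn]⟩
    · simp only [Pi.smul_apply, LinearMap.smul_apply, map_smul, smul_comm _ c]
      rw [← smul_finsum, ← smul_finsum, ← smul_finsum, ← h𝒴.jacobi, smul_sub]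
    · simp only [Pi.smul_apply, LinearMap.smul_apply, h𝒴.L_neg_one, smul_comm _ c]

/-- The fusion rule among `W₁`, `W₂` and `W₃`: the dimension of the space of intertwining operators
of type `(W₃; W₁ W₂)`. -/
def fusionRule (M₁ : RGradedModule 𝒱 W₁) (M₂ : RGradedModule 𝒱 W₂)
    (M₃ : RGradedModule 𝒱 W₃) : Cardinal :=
  Module.rank ℂ (intertwiningOperators M₁ M₂ M₃)

end Intertwining

end

open VertexOperator (ncoeff)

/-! An intertwining operator is determined by its matrix coefficients `φ (𝒴 n w₁ w₂)` with `w₁`,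
`w₂`, `φ` homogeneous of weights `r₁`, `r₂`, `r₃`. If one of the three vectors lies in the `C₁` part
of its module, the Jacobi identity moves the mode `u₋₁` onto the other two, and every resulting
coefficient has total weight `r₁ + r₂ + r₃` smaller by at least 1. This is shown in
`apply_eq_zero_of_mem_c1Component_left`, its `right` analogue and
`apply_eq_zero_of_mem_dualC1Component`.

By cofiniteness, each module coincides with its `C₁` part in all but finitely many weights. Weights
are bounded below, so induction on total weight shows that `𝒴` vanishes once its coefficients at the
finitely many exceptional triples of weights vanish (`eq_zero_of_apply_eq_zero`). At a fixed triple,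
the `L(0)`-weights allow only the mode `n = r₁ + r₂ - r₃ - 1`. The space of intertwining operators
therefore embeds in a finite product of Hom spaces between finite-dimensional weight spaces. -/

/-- If `W / C` is finite-dimensional and every vector has finitely many nonzero components `p i w`,
then for all but finitely many `i` the components of `C` exhaust those of `W`. -/
theorem exists_finset_component_mem_map {ι W U : Type*} [AddCommGroup W] [Module ℂ W]
    [AddCommGroup U] [Module ℂ U] (C : Submodule ℂ W) (hC : FiniteDimensional ℂ (W ⧸ C))
    (p : ι → W →ₗ[ℂ] U) (hp : ∀ w, {i | p i w ≠ 0}.Finite) :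
    ∃ R : Finset ι, ∀ i ∉ R, ∀ w, p i w ∈ C.map (p i) := by
  classical
  let b := Module.finBasis ℂ (W ⧸ C)
  choose s hs using fun j => C.mkQ_surjective (b j)
  -- Outside the supports of the lifts `s j`, correcting `w` by a combination of them puts it in `C`
  -- without changing its component.
  refine ⟨Finset.univ.biUnion fun j => (hp (s j)).toFinset, fun i hi w => ?_⟩
  have hi' : ∀ j, p i (s j) = 0 := by simpa using hi
  refine ⟨w - ∑ j, b.repr (C.mkQ w) j • s j, ?_, ?_⟩
  · refine (Submodule.Quotient.mk_eq_zero C).1 ?_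
    rw [← C.mkQ_apply, map_sub, map_sum]
    simp only [map_smul, hs, b.sum_repr, sub_self]
  · simp [hi']

/-! ### Weight components of a module and of `C₁(W)` -/

namespace RGradedModule

variable {V : Type*} [AddCommGroup V] [Module ℂ V] {𝒱 : VertexOperatorAlgebra V}
  {W : Type*} [AddCommGroup W] [Module ℂ W]

/-- The projection of `W` onto the homogeneous subspace `W₍ᵣ₎`. -/
noncomputable def component (M : RGradedModule 𝒱 W) (r : ℝ) : W →ₗ[ℂ] M.grading r :=
  DirectSum.component ℂ ℝ (fun s => M.grading s) r ∘ₗ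
    (LinearEquiv.ofBijective (DirectSum.coeLinearMap M.grading) M.isInternal).symm.toLinearMap

theorem ofBijective_symm_of_mem (M : RGradedModule 𝒱 W) {s : ℝ} {w : W} (hw : w ∈ M.grading s) :
    (LinearEquiv.ofBijective (DirectSum.coeLinearMap M.grading) M.isInternal).symm w
      = DirectSum.lof ℂ ℝ (fun i => M.grading i) s ⟨w, hw⟩ := by
  rw [LinearEquiv.symm_apply_eq]
  exact (DirectSum.coeLinearMap_lof M.grading s ⟨w, hw⟩).symm

theorem component_of_mem (M : RGradedModule 𝒱 W) {r : ℝ} {w : W} (hw : w ∈ M.grading r) :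
    (M.component r w : W) = w := by
  simp [component, M.ofBijective_symm_of_mem hw, DirectSum.component.lof_self]

theorem component_of_mem_of_ne (M : RGradedModule 𝒱 W) {r s : ℝ} (h : s ≠ r) {w : W}
    (hw : w ∈ M.grading s) : M.component r w = 0 := by
  simp [component, M.ofBijective_symm_of_mem hw, DirectSum.component.of, h]

theorem finite_component_ne_zero (M : RGradedModule 𝒱 W) (w : W) :
    {r | M.component r w ≠ 0}.Finite := by
  classical
  exact DFinsupp.finite_support
    ((LinearEquiv.ofBijective (DirectSum.coeLinearMap M.grading) M.isInternal).symm w)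

theorem eq_zero_of_component_eq_zero (M : RGradedModule 𝒱 W) {w : W}
    (h : ∀ r, M.component r w = 0) : w = 0 :=
  (LinearEquiv.map_eq_zero_iff _).1 (DFinsupp.ext h : (LinearEquiv.ofBijective
    (DirectSum.coeLinearMap M.grading) M.isInternal).symm w = 0)

theorem induction_homogeneous (M : RGradedModule 𝒱 W) {p : W → Prop} (zero : p 0)
    (hom : ∀ r, ∀ w ∈ M.grading r, p w) (add : ∀ u v, p u → p v → p (u + v)) (w : W) : p w := by
  have : w ∈ ⨆ r, M.grading r := by rw [M.isInternal.submodule_iSup_eq_top]; trivial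
  exact Submodule.iSup_induction _ (motive := p) this hom zero add

/-- The part of weight `r` of `C₁(W)`. -/
def c1Component (M : RGradedModule 𝒱 W) (r : ℝ) : Submodule ℂ W :=
  Submodule.span ℂ {x | ∃ m : ℤ, 0 < m ∧ ∃ u ∈ 𝒱.grading m, ∃ w ∈ M.grading (r - m),
    (ncoeff (M.Y u) (-1)) w = x}

theorem positivePart_induction {p : ∀ v, v ∈ 𝒱.positivePart → Prop} (zero : p 0 (zero_mem _))
    (hom : ∀ m : ℤ, ∀ hm : 0 < m, ∀ v, ∀ hv : v ∈ 𝒱.grading m,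
      p v (Submodule.mem_iSup_of_mem ⟨m, hm⟩ hv))
    (add : ∀ u v hu hv, p u hu → p v hv → p (u + v) (add_mem hu hv))
    {v : V} (hv : v ∈ 𝒱.positivePart) : p v hv :=
  Submodule.iSup_induction' _ (motive := p) (fun m => hom m.1 m.2) zero
    (fun u v hu hv => add u v hu hv) hv

/-- `C₁(W)` is a graded subspace: for homogeneous `u` and `x`, the weight `r` component of `u₋₁ x`
is either `u₋₁ x` itself or zero. Thus projecting `C₁(W)` to weight `r` lands in `c1Component`, and
`exists_finset_component_mem_map` applies. -/
theorem exists_finset_grading_le_c1Component (M : RGradedModule 𝒱 W) (hc : IsC1Cofinite 𝒱 M.Y) :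
    ∃ R : Finset ℝ, ∀ r ∉ R, M.grading r ≤ M.c1Component r := by
  obtain ⟨R, hR⟩ := exists_finset_component_mem_map _ hc
    (fun r => (M.grading r).subtype ∘ₗ M.component r)
    (fun w => by simpa using M.finite_component_ne_zero w)
  refine ⟨R, fun r hr w hw => ?_⟩
  have h := hR r hr w
  rw [LinearMap.comp_apply, Submodule.subtype_apply, M.component_of_mem hw] at h
  refine (Submodule.map_le_iff_le_comap.2 (Submodule.span_le.2 ?_) :
    Submodule.map _ (C1Subspace 𝒱 M.Y) ≤ M.c1Component r) h
  rintro _ ⟨u, hu, x, rfl⟩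
  change (M.component r _ : W) ∈ M.c1Component r
  induction hu using positivePart_induction with
  | zero => simp
  | add u v _ _ hu hv =>
    simp only [map_add, LinearMap.add_apply, Pi.add_apply, Submodule.coe_add]
    exact add_mem hu hv
  | hom m hm u hu' =>
    induction x using M.induction_homogeneous with
    | zero => simp
    | add x y hx hy =>
      simp only [map_add, Submodule.coe_add]
      exact add_mem hx hy
    | hom s x hx =>
      have hmem := M.mode_mem (-1) hu' hx
      by_cases hs : s = r - m
      · subst hs
        rw [M.component_of_mem (by convert hmem using 2; push_cast; ring)]
        exact Submodule.subset_span ⟨m, hm, u, hu', x, hx, rfl⟩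
      · rw [M.component_of_mem_of_ne (fun h => hs ?_) hmem]
        · simp
        · push_cast at h; linarith

/-! ### Homogeneous functionals and `C₁(W')` -/

/-- The functionals on `W` that vanish on all homogeneous subspaces except `W₍ᵣ₎`. -/
def dualGrading (M : RGradedModule 𝒱 W) (r : ℝ) : Submodule ℂ (Module.Dual ℂ W) where
  carrier := {φ | ∀ s, s ≠ r → ∀ w ∈ M.grading s, φ w = 0}
  zero_mem' := by simp
  add_mem' hφ hψ s hs w hw := by simp [hφ s hs w hw, hψ s hs w hw]
  smul_mem' c φ hφ s hs w hw := by simp [hφ s hs w hw]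

/-- Since `vₙ` shifts weights by `m - n - 1`, its transpose shifts them by the opposite amount. This
lets modes acting on the output of `𝒴` be absorbed into the functional. -/
theorem comp_mode_mem_dualGrading (M : RGradedModule 𝒱 W) {m n : ℤ} {v : V}
    (hv : v ∈ 𝒱.grading m) {r s : ℝ} (hs : s = r - m + n + 1) {φ : Module.Dual ℂ W}
    (hφ : φ ∈ M.dualGrading r) : φ ∘ₗ ncoeff (M.Y v) n ∈ M.dualGrading s := by
  intro t ht w hw
  refine hφ _ (fun h => ht ?_) _ (M.mode_mem n hv hw)
  linarith

theorem apply_component_of_mem_dualGrading (M : RGradedModule 𝒱 W) {r : ℝ} {φ : Module.Dual ℂ W}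
    (hφ : φ ∈ M.dualGrading r) (w : W) : φ (M.component r w) = φ w := by
  induction w using M.induction_homogeneous with
  | zero => simp
  | add u v hu hv => simp [hu, hv]
  | hom s w hw =>
    by_cases h : s = r
    · subst h; rw [M.component_of_mem hw]
    · rw [M.component_of_mem_of_ne h hw, hφ s h w hw]; simp

theorem apply_L_zero_of_mem_dualGrading (M : RGradedModule 𝒱 W) {r : ℝ} {φ : Module.Dual ℂ W}
    (hφ : φ ∈ M.dualGrading r) (w : W) : φ ((ncoeff (M.Y 𝒱.ω) 1) w) = r * φ w := by
  induction w using M.induction_homogeneous with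
  | zero => simp
  | add u v hu hv => simp [hu, hv, mul_add]
  | hom s w hw =>
    rw [M.L_zero s w hw]
    by_cases h : s = r
    · subst h; simp
    · simp [hφ s h w hw]

theorem comp_component_mem_dualGrading (M : RGradedModule 𝒱 W) (r : ℝ) (φ : Module.Dual ℂ W) :
    φ ∘ₗ (M.grading r).subtype ∘ₗ M.component r ∈ M.dualGrading r := by
  intro s hs w hw
  simp [M.component_of_mem_of_ne hs hw]

theorem dualGrading_le_gradedDual (M : RGradedModule 𝒱 W) (r : ℝ) :
    M.dualGrading r ≤ M.gradedDual := by
  intro φ hφ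
  refine (Set.finite_singleton r).subset ?_
  rintro s ⟨w, hw, h⟩
  by_contra hs
  exact h (hφ s hs w hw)

theorem finite_comp_component_ne_zero (M : RGradedModule 𝒱 W) (φ : M.gradedDual) :
    {r | φ.1 ∘ₗ (M.grading r).subtype ∘ₗ M.component r ≠ 0}.Finite := by
  refine Set.Finite.subset (s := {r : ℝ | ∃ w ∈ M.grading r, φ.1 w ≠ 0}) φ.2 fun r hr => ?_
  by_contra h
  simp only [Set.mem_ofPred_eq, not_exists, not_and, not_not] at h
  exact hr (LinearMap.ext fun w => h _ (M.component r w).2)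

/-- The part of weight `r` of `C₁(W')`, as a space of functionals on `W`. -/
def dualC1Component (M : RGradedModule 𝒱 W) (r : ℝ) : Submodule ℂ (Module.Dual ℂ W) :=
  Submodule.span ℂ {φ | ∃ m : ℤ, 0 < m ∧ ∃ u ∈ 𝒱.grading m, ∃ ψ ∈ M.dualGrading (r - m),
    ψ ∘ₗ M.oppositeMode (-1) u = φ}

/-- The opposite mode of index `-1` lowers weight by exactly `m`, so it intertwines the projections
to weights `r` and `r - m`. This is what makes `C₁(W')` graded. -/
theorem comp_oppositeMode_comp_component (M : RGradedModule 𝒱 W) {m : ℤ} {u : V}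
    (hu : u ∈ 𝒱.grading m) (r : ℝ) (φ : Module.Dual ℂ W) :
    (φ ∘ₗ M.oppositeMode (-1) u) ∘ₗ (M.grading r).subtype ∘ₗ M.component r
      = (φ ∘ₗ (M.grading (r - m)).subtype ∘ₗ M.component (r - m)) ∘ₗ M.oppositeMode (-1) u := by
  ext w
  simp only [LinearMap.comp_apply, Submodule.subtype_apply]
  congr 1
  induction w using M.induction_homogeneous with
  | zero => simp
  | add x y hx hy => simp [hx, hy]
  | hom s w hw =>
    have hmem := M.oppositeMode_mem (-1) hu hw
    by_cases hs : s = r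
    · subst hs
      rw [M.component_of_mem hw, M.component_of_mem (by convert hmem using 2; push_cast; ring)]
    · rw [M.component_of_mem_of_ne hs hw,
        M.component_of_mem_of_ne (fun h => hs (by push_cast at h; linarith)) hmem]
      simp

theorem exists_finset_dualGrading_le_dualC1Component (M : RGradedModule 𝒱 W)
    (hc : IsC1Cofinite 𝒱 M.contragredientY) :
    ∃ R : Finset ℝ, ∀ r ∉ R, M.dualGrading r ≤ M.dualC1Component r := by
  obtain ⟨R, hR⟩ := exists_finset_component_mem_map _ hc
    (fun r => ((M.grading r).subtype ∘ₗ M.component r).dualMap ∘ₗ M.gradedDual.subtype)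
    -- The weight `r` component of a functional is its precomposition with the projection of `W`
    -- onto weight `r`.
    (fun φ => M.finite_comp_component_ne_zero φ)
  refine ⟨R, fun r hr φ hφ => ?_⟩
  have h := hR r hr ⟨φ, M.dualGrading_le_gradedDual r hφ⟩
  have hφ' : (((M.grading r).subtype ∘ₗ M.component r).dualMap ∘ₗ M.gradedDual.subtype)
      ⟨φ, M.dualGrading_le_gradedDual r hφ⟩ = φ :=
    LinearMap.ext fun w => M.apply_component_of_mem_dualGrading hφ w
  rw [hφ'] at h
  refine (Submodule.map_le_iff_le_comap.2 (Submodule.span_le.2 ?_) :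
    Submodule.map _ (C1Subspace 𝒱 M.contragredientY) ≤ M.dualC1Component r) h
  rintro _ ⟨u, hu, ψ, rfl⟩
  have hmode : ((ncoeff (M.contragredientY u) (-1)) ψ).1 = ψ.1 ∘ₗ M.oppositeMode (-1) u :=
    LinearMap.ext fun w => M.contragredientY_mode u (-1) ψ w
  change ((ncoeff (M.contragredientY u) (-1)) ψ).1 ∘ₗ (M.grading r).subtype ∘ₗ M.component r ∈
    M.dualC1Component r
  rw [hmode]
  clear hmode
  induction hu using positivePart_induction with
  | zero => simp
  | add u v _ _ hu hv =>
    rw [map_add, LinearMap.comp_add, LinearMap.add_comp]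
    exact add_mem hu hv
  | hom m hm u hu' =>
    rw [M.comp_oppositeMode_comp_component hu']
    exact Submodule.subset_span ⟨m, hm, u, hu', _, M.comp_component_mem_dualGrading _ _, rfl⟩

theorem dualGrading_eq_zero (M : RGradedModule 𝒱 W) {r : ℝ} (hr : M.grading r = ⊥)
    {φ : Module.Dual ℂ W} (hφ : φ ∈ M.dualGrading r) : φ = 0 := by
  ext w
  rw [← M.apply_component_of_mem_dualGrading hφ w, show (M.component r w : W) = 0 from
      (Submodule.eq_bot_iff _).1 hr _ (M.component r w).2, map_zero, LinearMap.zero_apply]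

end RGradedModule

/-! ### Auxiliary linear algebra -/

theorem finiteDimensional_of_forall_eq_zero {ι X : Type*} [Finite ι] [AddCommGroup X] [Module ℂ X]
    {F : ι → Type*} [∀ i, AddCommGroup (F i)] [∀ i, Module ℂ (F i)]
    [∀ i, FiniteDimensional ℂ (F i)] (f : ∀ i, X →ₗ[ℂ] F i)
    (hf : ∀ x, (∀ i, f i x = 0) → x = 0) : FiniteDimensional ℂ X :=
  Module.Finite.of_injective (LinearMap.pi f)
    (LinearMap.ker_eq_bot.1 (LinearMap.ker_eq_bot'.2 fun x hx => hf x (congrFun hx)))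

theorem apply_finsum_eq_zero {ι W : Type*} [AddCommGroup W] [Module ℂ W] (φ : Module.Dual ℂ W)
    {f : ι → W} (hf : ∀ i, φ (f i) = 0) : φ (∑ᶠ i, f i) = 0 :=
  finsum_induction (p := fun x => φ x = 0) (map_zero φ)
    (fun _ _ hx hy => by rw [map_add, hx, hy, add_zero]) hf

/-! ### Consequences of the Jacobi identity -/

namespace IsIntertwiningOperator

variable {V : Type*} [AddCommGroup V] [Module ℂ V] {𝒱 : VertexOperatorAlgebra V}
  {W₁ W₂ W₃ : Type*} [AddCommGroup W₁] [Module ℂ W₁] [AddCommGroup W₂] [Module ℂ W₂]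
  [AddCommGroup W₃] [Module ℂ W₃] {M₁ : RGradedModule 𝒱 W₁} {M₂ : RGradedModule 𝒱 W₂}
  {M₃ : RGradedModule 𝒱 W₃} {𝒴 : ℂ → W₁ →ₗ[ℂ] W₂ →ₗ[ℂ] W₃}

/-- The commutator formula. -/
theorem commutator (h : IsIntertwiningOperator M₁ M₂ M₃ 𝒴) (v : V) (w₁ : W₁) (w₂ : W₂) (m : ℤ)
    (n : ℂ) :
    (ncoeff (M₃.Y v) m) (𝒴 n w₁ w₂) - 𝒴 n w₁ ((ncoeff (M₂.Y v) m) w₂)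
      = ∑ᶠ i : ℕ, ((Ring.choose m i : ℤ) : ℂ) • 𝒴 (m + n - i) ((ncoeff (M₁.Y v) i) w₁) w₂ := by
  have := h.jacobi v w₁ w₂ 0 m n
  rw [finsum_eq_single _ 0, finsum_eq_single _ 0] at this
  · simpa using this
  · intro i hi
    simp [Ring.choose_zero_pos ℤ (Nat.pos_of_ne_zero hi)]
  · intro i hi
    simp [Ring.choose_zero_pos ℤ (Nat.pos_of_ne_zero hi)]

/-- The iterate formula for the mode `v₋₁`. -/
theorem iterate_neg_one (h : IsIntertwiningOperator M₁ M₂ M₃ 𝒴) (v : V) (w₁ : W₁) (w₂ : W₂)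
    (n : ℂ) :
    𝒴 n ((ncoeff (M₁.Y v) (-1)) w₁) w₂
      = (∑ᶠ i : ℕ, ((-1 : ℂ) ^ i * (Ring.choose (-1 : ℤ) i : ℤ)) •
          (ncoeff (M₃.Y v) (-1 - i)) (𝒴 (n + i) w₁ w₂))
        - ∑ᶠ i : ℕ, ((-1 : ℂ) ^ (-1 : ℤ) * (-1 : ℂ) ^ i * (Ring.choose (-1 : ℤ) i : ℤ)) •
          𝒴 (n - 1 - i) w₁ ((ncoeff (M₂.Y v) i) w₂) := by
  have := h.jacobi v w₁ w₂ (-1) 0 n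
  rw [finsum_eq_single (fun i : ℕ => ((Ring.choose (0 : ℤ) i : ℤ) : ℂ) • _) 0] at this
  · simpa [← sub_eq_add_neg] using this.symm
  · intro i hi
    simp [Ring.choose_zero_pos ℤ (Nat.pos_of_ne_zero hi)]

/-- In the commutator with `L(0) = ω₁` only `i = 0, 1` survive: `L(-1) w₁` contributes `-(n + 1)` by
the derivative property, and `L(0) w₁` contributes `r₁`. -/
theorem L_zero_apply (h : IsIntertwiningOperator M₁ M₂ M₃ 𝒴) {r₁ r₂ : ℝ} {w₁ : W₁} {w₂ : W₂}
    (hw₁ : w₁ ∈ M₁.grading r₁) (hw₂ : w₂ ∈ M₂.grading r₂) (n : ℂ) :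
    (ncoeff (M₃.Y 𝒱.ω) 1) (𝒴 n w₁ w₂) = (r₁ + r₂ - n - 1) • 𝒴 n w₁ w₂ := by
  have := h.commutator 𝒱.ω w₁ w₂ 1 n
  rw [finsum_eq_sum_of_support_subset (s := Finset.range 2)] at this
  · simp only [Finset.sum_range_succ, Finset.sum_range_zero, Nat.cast_zero, Nat.cast_one,
      h.L_neg_one, M₁.L_zero _ _ hw₁, M₂.L_zero _ _ hw₂, map_smul, LinearMap.smul_apply,
      Ring.choose_zero_right, Ring.choose_one_right, Int.cast_one, one_smul, zero_add, sub_zero,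
      add_sub_cancel_left] at this
    rw [sub_eq_iff_eq_add] at this
    rw [this]
    module
  · intro i hi
    by_contra hlt
    have h2 : 1 < i := by simpa using hlt
    have : Ring.choose (1 : ℤ) i = 0 := by
      have := Ring.choose_natCast (R := ℤ) 1 i
      rw [Nat.choose_eq_zero_of_lt h2] at this
      simpa using this
    exact hi (by simp [this])

/-- Only one mode contributes to the matrix coefficients of given weights. -/
theorem apply_eq_zero_of_ne (h : IsIntertwiningOperator M₁ M₂ M₃ 𝒴) {r₁ r₂ r₃ : ℝ} {w₁ : W₁}
    {w₂ : W₂} (hw₁ : w₁ ∈ M₁.grading r₁) (hw₂ : w₂ ∈ M₂.grading r₂) {φ : Module.Dual ℂ W₃}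
    (hφ : φ ∈ M₃.dualGrading r₃) {n : ℂ} (hn : n ≠ r₁ + r₂ - r₃ - 1) : φ (𝒴 n w₁ w₂) = 0 := by
  -- Evaluating `φ` on `L(0) (𝒴 n w₁ w₂)` in two ways gives the factors `r₃` and `r₁ + r₂ - n - 1`;
  -- if they differ, the coefficient is zero.
  have h0 := M₃.apply_L_zero_of_mem_dualGrading hφ (𝒴 n w₁ w₂)
  rw [h.L_zero_apply hw₁ hw₂, map_smul, smul_eq_mul, ← sub_eq_zero, ← sub_mul] at h0
  refine (mul_eq_zero.1 h0).resolve_left fun h1 => hn ?_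
  linear_combination -h1

/-! ### Reduction of total weight -/

/-- All matrix coefficients with total weight less than `t` vanish. -/
def VanishesBelow (M₁ : RGradedModule 𝒱 W₁) (M₂ : RGradedModule 𝒱 W₂) (M₃ : RGradedModule 𝒱 W₃)
    (𝒴 : ℂ → W₁ →ₗ[ℂ] W₂ →ₗ[ℂ] W₃) (t : ℝ) : Prop :=
  ∀ r₁ r₂ r₃ : ℝ, r₁ + r₂ + r₃ < t → ∀ w₁ ∈ M₁.grading r₁, ∀ w₂ ∈ M₂.grading r₂,
    ∀ φ ∈ M₃.dualGrading r₃, ∀ n : ℂ, φ (𝒴 n w₁ w₂) = 0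

/-- The iterate formula rewrites `𝒴 n (u₋₁ w) w₂` through `u₋₁₋ᵢ` on the output, where the total
weight drops by `2m + i`, and `uᵢ` on `w₂`, where it drops by `i + 1`. Since `m` is a positive
integer, both drops are at least 1. -/
theorem apply_eq_zero_of_mem_c1Component_left (h : IsIntertwiningOperator M₁ M₂ M₃ 𝒴)
    {t r₁ r₂ r₃ : ℝ} (ht : VanishesBelow M₁ M₂ M₃ 𝒴 t) (hr : r₁ + r₂ + r₃ < t + 1) {w₁ : W₁}
    {w₂ : W₂} (hw₁ : w₁ ∈ M₁.c1Component r₁) (hw₂ : w₂ ∈ M₂.grading r₂) {φ : Module.Dual ℂ W₃}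
    (hφ : φ ∈ M₃.dualGrading r₃) (n : ℂ) : φ (𝒴 n w₁ w₂) = 0 := by
  induction hw₁ using Submodule.span_induction with
  | zero => simp
  | add x y _ _ hx hy => simp [hx, hy]
  | smul c x _ hx => simp [hx]
  | mem x hx =>
    obtain ⟨m, hm, u, hu, w, hw, rfl⟩ := hx
    have hm' : (1 : ℝ) ≤ m := by exact_mod_cast hm
    rw [h.iterate_neg_one, map_sub, apply_finsum_eq_zero φ, apply_finsum_eq_zero φ, sub_zero]
    · intro i
      rw [map_smul, ht _ _ _ ?_ _ hw _ (M₂.mode_mem i hu hw₂) _ hφ, smul_zero]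
      push_cast
      linarith [Nat.cast_nonneg (α := ℝ) i]
    · intro i
      have := ht _ _ _ ?_ _ hw _ hw₂ _
        (M₃.comp_mode_mem_dualGrading (n := -1 - i) hu rfl hφ) (n + i)
      · rw [map_smul]
        rw [LinearMap.comp_apply] at this
        rw [this, smul_zero]
      · push_cast
        linarith [Nat.cast_nonneg (α := ℝ) i]

/-- The commutator with `u₋₁` trades its action on `w` for `u₋₁` on the output, a drop of `2m`, and
for `uᵢ` on `w₁`, a drop of `i + 1`. -/
theorem apply_eq_zero_of_mem_c1Component_right (h : IsIntertwiningOperator M₁ M₂ M₃ 𝒴)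
    {t r₁ r₂ r₃ : ℝ} (ht : VanishesBelow M₁ M₂ M₃ 𝒴 t) (hr : r₁ + r₂ + r₃ < t + 1) {w₁ : W₁}
    {w₂ : W₂} (hw₁ : w₁ ∈ M₁.grading r₁) (hw₂ : w₂ ∈ M₂.c1Component r₂) {φ : Module.Dual ℂ W₃}
    (hφ : φ ∈ M₃.dualGrading r₃) (n : ℂ) : φ (𝒴 n w₁ w₂) = 0 := by
  induction hw₂ using Submodule.span_induction with
  | zero => simp
  | add x y _ _ hx hy => simp [hx, hy]
  | smul c x _ hx => simp [hx]
  | mem x hx =>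
    obtain ⟨m, hm, u, hu, w, hw, rfl⟩ := hx
    have hm' : (1 : ℝ) ≤ m := by exact_mod_cast hm
    have hcomm := congrArg φ (h.commutator u w₁ w (-1) n)
    rw [map_sub, apply_finsum_eq_zero φ] at hcomm
    · have := ht _ _ _ ?_ _ hw₁ _ hw _ (M₃.comp_mode_mem_dualGrading (n := -1) hu rfl hφ) n
      · rw [LinearMap.comp_apply] at this
        rw [this, zero_sub, neg_eq_zero] at hcomm
        exact hcomm
      · push_cast
        linarith
    · intro i
      rw [map_smul, ht _ _ _ ?_ _ (M₁.mode_mem i hu hw₁) _ hw _ hφ, smul_zero]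
      push_cast
      linarith [Nat.cast_nonneg (α := ℝ) i]

/-- Each term of the opposite mode is a mode of `L(1)^k u` applied to the output of `𝒴`. Commuting
it past `𝒴` puts it on `w₂`, with total drop `2m`, or on `w₁`, with drop `k + i + 1`; both counts
include the `m` by which `ψ` lies below `φ`. -/
theorem apply_eq_zero_of_mem_dualC1Component (h : IsIntertwiningOperator M₁ M₂ M₃ 𝒴)
    {t r₁ r₂ r₃ : ℝ} (ht : VanishesBelow M₁ M₂ M₃ 𝒴 t) (hr : r₁ + r₂ + r₃ < t + 1) {w₁ : W₁}
    {w₂ : W₂} (hw₁ : w₁ ∈ M₁.grading r₁) (hw₂ : w₂ ∈ M₂.grading r₂) {φ : Module.Dual ℂ W₃}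
    (hφ : φ ∈ M₃.dualC1Component r₃) (n : ℂ) : φ (𝒴 n w₁ w₂) = 0 := by
  induction hφ using Submodule.span_induction with
  | zero => simp
  | add x y _ _ hx hy => simp [hx, hy]
  | smul c x _ hx => simp [hx]
  | mem x hx =>
    obtain ⟨m, hm, u, hu, ψ, hψ, rfl⟩ := hx
    have hm' : (1 : ℝ) ≤ m := by exact_mod_cast hm
    rw [LinearMap.comp_apply, M₃.oppositeMode_of_mem _ hu, LinearMap.smul_apply, map_smul]
    refine smul_eq_zero_of_right _ ?_
    refine finsum_induction (p := fun T : Module.End ℂ W₃ => ψ (T (𝒴 n w₁ w₂)) = 0) (by simp)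
      (fun S T hS hT => by simp [hS, hT]) fun k => ?_
    have hk := 𝒱.L_one_pow_mem hu k
    rw [LinearMap.smul_apply, map_smul]
    refine smul_eq_zero_of_right _ ?_
    -- The index equals `2m - k - 1`; as `L(1)^k u` has weight `m - k`, this mode lowers weight by
    -- `m` for every `k`.
    have hcomm := congrArg ψ (h.commutator ((ncoeff (𝒱.Y 𝒱.ω) 2 ^ k) u) w₁ w₂ (2 * m - k - -1 - 2) n)
    rw [map_sub, apply_finsum_eq_zero ψ, ht _ _ _ ?_ _ hw₁ _ (M₂.mode_mem _ hk hw₂) _ hψ,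
      sub_zero] at hcomm
    · exact hcomm
    · push_cast
      linarith
    · intro i
      rw [map_smul, ht _ _ _ ?_ _ (M₁.mode_mem i hk hw₁) _ hw₂ _ hψ, smul_zero]
      push_cast
      linarith [Nat.cast_nonneg (α := ℝ) i, Nat.cast_nonneg (α := ℝ) k]

/-- An intertwining operator is determined by its matrix coefficients with weights outside of which
the modules are spanned by `C₁`. -/
theorem eq_zero_of_apply_eq_zero (h : IsIntertwiningOperator M₁ M₂ M₃ 𝒴) {R₁ R₂ R₃ : Finset ℝ}
    (hR₁ : ∀ r ∉ R₁, M₁.grading r ≤ M₁.c1Component r)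
    (hR₂ : ∀ r ∉ R₂, M₂.grading r ≤ M₂.c1Component r)
    (hR₃ : ∀ r ∉ R₃, M₃.dualGrading r ≤ M₃.dualC1Component r)
    (h0 : ∀ r₁ ∈ R₁, ∀ r₂ ∈ R₂, ∀ r₃ ∈ R₃, ∀ w₁ ∈ M₁.grading r₁, ∀ w₂ ∈ M₂.grading r₂,
      ∀ φ ∈ M₃.dualGrading r₃, ∀ n : ℂ, φ (𝒴 n w₁ w₂) = 0) : 𝒴 = 0 := by
  obtain ⟨N₁, hN₁⟩ := M₁.lower_bounded
  obtain ⟨N₂, hN₂⟩ := M₂.lower_bounded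
  obtain ⟨N₃, hN₃⟩ := M₃.lower_bounded
  -- Weights are real, but each reduction gains a full unit, so induction over `k` steps of length 1
  -- suffices. For `k = 0` some weight lies below its module's bound.
  have key : ∀ k : ℕ, VanishesBelow M₁ M₂ M₃ 𝒴 (N₁ + N₂ + N₃ + k) := by
    intro k
    induction k with
    | zero =>
      intro r₁ r₂ r₃ hr w₁ hw₁ w₂ hw₂ φ hφ n
      by_cases h1 : r₁ < N₁
      · rw [hN₁ _ h1, Submodule.mem_bot] at hw₁
        simp [hw₁]
      by_cases h2 : r₂ < N₂
      · rw [hN₂ _ h2, Submodule.mem_bot] at hw₂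
        simp [hw₂]
      have h3 : r₃ < N₃ := by push_cast at hr; linarith
      simp [M₃.dualGrading_eq_zero (hN₃ _ h3) hφ]
    | succ k ih =>
      intro r₁ r₂ r₃ hr w₁ hw₁ w₂ hw₂ φ hφ n
      rw [Nat.cast_succ, ← add_assoc] at hr
      by_cases h1 : r₁ ∈ R₁
      · by_cases h2 : r₂ ∈ R₂
        · by_cases h3 : r₃ ∈ R₃
          · exact h0 _ h1 _ h2 _ h3 _ hw₁ _ hw₂ _ hφ n
          · exact h.apply_eq_zero_of_mem_dualC1Component ih hr hw₁ hw₂ (hR₃ _ h3 hφ) n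
        · exact h.apply_eq_zero_of_mem_c1Component_right ih hr hw₁ (hR₂ _ h2 hw₂) hφ n
      · exact h.apply_eq_zero_of_mem_c1Component_left ih hr (hR₁ _ h1 hw₁) hw₂ hφ n
  funext n
  ext w₁ w₂
  induction w₁ using M₁.induction_homogeneous with
  | zero => simp
  | add x y hx hy => simpa using congrArg₂ (· + ·) hx hy
  | hom r₁ w₁ hw₁ =>
    induction w₂ using M₂.induction_homogeneous with
    | zero => simp
    | add x y hx hy => simpa using congrArg₂ (· + ·) hx hy
    | hom r₂ w₂ hw₂ =>
      refine M₃.eq_zero_of_component_eq_zero fun r => Subtype.ext ?_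
      -- A vector vanishes if all functionals kill each of its components; a functional precomposed
      -- with the projection is homogeneous, so `key` applies for `k` large.
      refine (Module.forall_dual_apply_eq_zero_iff ℂ _).1 fun φ => ?_
      obtain ⟨k, hk⟩ := exists_nat_gt (r₁ + r₂ + r - (N₁ + N₂ + N₃))
      exact key k r₁ r₂ r (by linarith) w₁ hw₁ w₂ hw₂ _
        (M₃.comp_component_mem_dualGrading r φ) n

/-! ### Embedding into a finite product of Hom spaces -/

/-- The component `W₁₍ᵣ₁₎ ⊗ W₂₍ᵣ₂₎ → W₃₍ᵣ₃₎` of the only mode of `𝒴` for which it can be nonzero. -/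
noncomputable def homogeneousPart (M₁ : RGradedModule 𝒱 W₁) (M₂ : RGradedModule 𝒱 W₂)
    (M₃ : RGradedModule 𝒱 W₃) (r₁ r₂ r₃ : ℝ) :
    (ℂ → W₁ →ₗ[ℂ] W₂ →ₗ[ℂ] W₃) →ₗ[ℂ]
      M₁.grading r₁ →ₗ[ℂ] M₂.grading r₂ →ₗ[ℂ] M₃.grading r₃ where
  toFun 𝒴 := ((𝒴 (r₁ + r₂ - r₃ - 1)).domRestrict₁₂ (M₁.grading r₁) (M₂.grading r₂)).compr₂
    (M₃.component r₃)
  map_add' 𝒴 𝒵 := LinearMap.ext₂ fun w₁ w₂ => (M₃.component r₃).map_add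
    (𝒴 (r₁ + r₂ - r₃ - 1) w₁ w₂) (𝒵 (r₁ + r₂ - r₃ - 1) w₁ w₂)
  map_smul' c 𝒴 := LinearMap.ext₂ fun w₁ w₂ => (M₃.component r₃).map_smul c
    (𝒴 (r₁ + r₂ - r₃ - 1) w₁ w₂)

/-- The maps `homogeneousPart` at the finitely many triples in `R₁ × R₂ × R₃` are jointly injective
on intertwining operators: they control the one admissible mode, and all other modes vanish there by
weight. -/
theorem finiteDimensional_of_finset {R₁ R₂ R₃ : Finset ℝ}
    (hR₁ : ∀ r ∉ R₁, M₁.grading r ≤ M₁.c1Component r)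
    (hR₂ : ∀ r ∉ R₂, M₂.grading r ≤ M₂.c1Component r)
    (hR₃ : ∀ r ∉ R₃, M₃.dualGrading r ≤ M₃.dualC1Component r) :
    FiniteDimensional ℂ (intertwiningOperators M₁ M₂ M₃) := by
  have := M₁.finiteDimensional
  have := M₂.finiteDimensional
  have := M₃.finiteDimensional
  refine finiteDimensional_of_forall_eq_zero (F := fun p : R₁ × R₂ × R₃ =>
      M₁.grading p.1 →ₗ[ℂ] M₂.grading p.2.1 →ₗ[ℂ] M₃.grading p.2.2) (fun p : R₁ × R₂ × R₃ =>
    homogeneousPart M₁ M₂ M₃ p.1 p.2.1 p.2.2 ∘ₗ Submodule.subtype _) fun 𝒴 h𝒴 => ?_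
  refine Subtype.ext (eq_zero_of_apply_eq_zero 𝒴.2 hR₁ hR₂ hR₃ ?_)
  intro r₁ h₁ r₂ h₂ r₃ h₃ w₁ hw₁ w₂ hw₂ φ hφ n
  by_cases hn : n = r₁ + r₂ - r₃ - 1
  · have h : M₃.component r₃ (𝒴.1 (r₁ + r₂ - r₃ - 1) w₁ w₂) = 0 :=
      LinearMap.congr_fun (LinearMap.congr_fun
        (h𝒴 (⟨r₁, h₁⟩, ⟨r₂, h₂⟩, ⟨r₃, h₃⟩)) ⟨w₁, hw₁⟩) ⟨w₂, hw₂⟩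
    rw [hn, ← M₃.apply_component_of_mem_dualGrading hφ, h, Submodule.coe_zero, map_zero]
  · exact apply_eq_zero_of_ne 𝒴.2 hw₁ hw₂ hφ hn

end IsIntertwiningOperator

theorem theorem3p1 {V W₁ W₂ W₃ : Type*} [AddCommGroup V] [Module ℂ V]
    [AddCommGroup W₁] [Module ℂ W₁] [AddCommGroup W₂] [Module ℂ W₂]
    [AddCommGroup W₃] [Module ℂ W₃]
    (𝒱 : VertexOperatorAlgebra V)
    (M₁ : RGradedModule 𝒱 W₁) (M₂ : RGradedModule 𝒱 W₂) (M₃ : RGradedModule 𝒱 W₃)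
    (hd₁ : M₁.IsDiscretelyGraded) (hd₂ : M₂.IsDiscretelyGraded) (hd₃ : M₃.IsDiscretelyGraded)
    (hc₁ : IsC1Cofinite 𝒱 M₁.Y) (hc₂ : IsC1Cofinite 𝒱 M₂.Y)
    (hc₃ : IsC1Cofinite 𝒱 M₃.contragredientY) :
    FiniteDimensional ℂ (intertwiningOperators M₁ M₂ M₃) ∧
      fusionRule M₁ M₂ M₃ < Cardinal.aleph0 := by
  obtain ⟨R₁, hR₁⟩ := M₁.exists_finset_grading_le_c1Component hc₁
  obtain ⟨R₂, hR₂⟩ := M₂.exists_finset_grading_le_c1Component hc₂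
  obtain ⟨R₃, hR₃⟩ := M₃.exists_finset_dualGrading_le_dualC1Component hc₃
  have := IsIntertwiningOperator.finiteDimensional_of_finset hR₁ hR₂ hR₃
  exact ⟨this, Module.rank_lt_aleph0 ℂ _⟩
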